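/- Let $X$ be a real or complex Banach space. For $1\le\lambda<\infty$, $X$ is an $\mathcal L_{1,\lambda}$-space if every finite-dimensional subspace $F$ of $X$ is contained in a finite-dimensional subspace $E$ of $X$ whose Banach--Mazur distance to $\ell_1^{\dim E}$ is at most $\lambda$; and $X$ is an $\mathcal L_1$-space if it is an $\mathcal L_{1,\lambda}$-space for some $\lambda\in[1,\infty)$. The space $X$ is subprojective if every infinite-dimensional closed subspace of $X$ contains an infinite-dimensional closed subspace that is complemented in $X$. Then an $\mathcal L_1$-space $X$ is subprojective if and only if it contains no infinite-dimensional reflexive closed subspace. -/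

import Mathlib

open scoped ENNReal NNReal

/-- The (multiplicative) Banach-Mazur distance between two normed spaces: the infimum of
`‖T‖ * ‖T⁻¹‖` over all linear homeomorphisms `T : E → F`, with value `∞` if there are none. -/
noncomputable def banachMazurDist (𝕜 : Type*) [RCLike 𝕜]
    (E : Type*) [NormedAddCommGroup E] [NormedSpace 𝕜 E]
    (F : Type*) [NormedAddCommGroup F] [NormedSpace 𝕜 F] : ℝ≥0∞ :=
  ⨅ T : E ≃L[𝕜] F, ‖(T : E →L[𝕜] F)‖ₑ * ‖(T.symm : F →L[𝕜] E)‖ₑ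

/-- `X` is an `ℒ_{p,C}`-space: every finite-dimensional subspace `F` of `X` is contained in a
finite-dimensional subspace `E` of `X` whose Banach-Mazur distance to `ℓ_p^{dim E}` is at
most `C`. -/
def IsScriptLpConstSpace (𝕜 : Type*) [RCLike 𝕜] (p : ℝ≥0∞) [Fact (1 ≤ p)] (C : ℝ≥0)
    (X : Type*) [NormedAddCommGroup X] [NormedSpace 𝕜 X] : Prop :=
  ∀ F : Submodule 𝕜 X, FiniteDimensional 𝕜 F →
    ∃ E : Submodule 𝕜 X, F ≤ E ∧ FiniteDimensional 𝕜 E ∧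
      banachMazurDist 𝕜 E (PiLp p fun _ : Fin (Module.finrank 𝕜 E) => 𝕜) ≤ C

/-- `X` is an `ℒ_p`-space: it is an `ℒ_{p,C}`-space for some `1 ≤ C < ∞`. -/
def IsScriptLpSpace (𝕜 : Type*) [RCLike 𝕜] (p : ℝ≥0∞) [Fact (1 ≤ p)]
    (X : Type*) [NormedAddCommGroup X] [NormedSpace 𝕜 X] : Prop :=
  ∃ C : ℝ≥0, 1 ≤ C ∧ IsScriptLpConstSpace 𝕜 p C X

/-- `X` is subprojective: every infinite-dimensional closed subspace of `X` contains an
infinite-dimensional closed subspace that is complemented in `X` (that is, the range of a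
continuous linear projection on `X`). -/
def IsSubprojective (𝕜 : Type*) [RCLike 𝕜]
    (X : Type*) [NormedAddCommGroup X] [NormedSpace 𝕜 X] : Prop :=
  ∀ M : Submodule 𝕜 X, IsClosed (M : Set X) → ¬ FiniteDimensional 𝕜 M →
    ∃ N : Submodule 𝕜 X, N ≤ M ∧ IsClosed (N : Set X) ∧ ¬ FiniteDimensional 𝕜 N ∧
      N.ClosedComplemented

/-- `X` is reflexive: the canonical map from `X` into its (topological) bidual is onto. -/
def IsReflexiveSpace (𝕜 : Type*) [RCLike 𝕜]
    (X : Type*) [NormedAddCommGroup X] [NormedSpace 𝕜 X] : Prop :=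
  Function.Surjective (NormedSpace.inclusionInDoubleDual 𝕜 X)

open Filter Topology

/-! The argument is a Kadec–Pełczyński dichotomy, carried out on finite-dimensional `ℓ₁`
coordinates. Every finite set of vectors lies in a frame, with coordinate norm equivalent to the
norm of `X` uniformly in the frame. An ultrafilter on finite sets, finer than `atTop`, turns weights
on the frames into functionals on `X`. Domination of a set plays the role of equi-integrability.

If a bounded set is not dominated, it contains vectors with large pieces on essentially disjoint
sets of coordinates (`L1Frame.exists_of_not_dominated`). After thinning by Rosenthal's lemma these
form an almost biorthogonal system. Its closed span is a complemented copy of `ℓ₁`, and no closed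
subspace containing it is reflexive.

If the unit ball of `M` is dominated, then `M` is reflexive: a James sequence would force averages
of functionals to lose more weighted `L₂` energy than is available. If moreover the subspace is
complemented, the projection lets its `ℓ₁` coordinates be replaced by ones bounded by a fixed finite
weight, so sup and `L₁` norms are equivalent and the dimension is bounded.

Hence without infinite-dimensional reflexive subspaces, every infinite-dimensional closed `M` has a
non-dominated ball and contains a complemented `ℓ₁`. Conversely, let `X` be subprojective and `N` an
infinite-dimensional complemented subspace of a reflexive `M`. A dominated ball makes `N`
finite-dimensional, and a non-dominated one contradicts reflexivity of `M`. -/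

/-- A coordinate system of `ℓ₁`-type for a subspace of `X`: every vector of `space` is the
combination of the `vec i` with coefficients `coord x i`, and the `ℓ₁`-norm of the coefficients is
at most `K * ‖x‖`. -/
structure L1Frame (𝕜 : Type*) [RCLike 𝕜] (X : Type*) [NormedAddCommGroup X] [NormedSpace 𝕜 X]
    (K : ℝ) where
  size : ℕ
  space : Submodule 𝕜 X
  coord : X → Fin size → 𝕜
  vec : Fin size → X
  sum_coord_le : ∀ x, ∑ i, ‖coord x i‖ ≤ K * ‖x‖
  coord_add : ∀ x ∈ space, ∀ y ∈ space, coord (x + y) = coord x + coord y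
  coord_smul : ∀ (c : 𝕜), ∀ x ∈ space, coord (c • x) = c • coord x
  sum_coord_smul_vec : ∀ x ∈ space, ∑ i, coord x i • vec i = x
  norm_vec_le : ∀ i, ‖vec i‖ ≤ 1

/-! ### Frames from local `ℓ₁` structure, and functionals as ultralimits -/

section

variable {𝕜 : Type*} [RCLike 𝕜] {X : Type*} [NormedAddCommGroup X] [NormedSpace 𝕜 X]

/-- Scaling the unit vectors by `‖T⁻¹‖⁻¹` and the coordinates by `‖T⁻¹‖` puts the whole distortion
into the coordinate bound. Coordinates are set to zero off `E`, so that this bound holds on all of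
`X`. -/
theorem exists_l1Frame_of_equiv {E : Submodule 𝕜 X} {n : ℕ}
    (T : E ≃L[𝕜] PiLp 1 fun _ : Fin n => 𝕜) {K : ℝ} (hK : 0 ≤ K)
    (hT : ‖(T.symm : (PiLp 1 fun _ : Fin n => 𝕜) →L[𝕜] E)‖ *
      ‖(T : E →L[𝕜] PiLp 1 fun _ : Fin n => 𝕜)‖ ≤ K) :
    ∃ f : L1Frame 𝕜 X K, f.space = E := by
  classical
  set c : ℝ := ‖(T.symm : (PiLp 1 fun _ : Fin n => 𝕜) →L[𝕜] E)‖ with hc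
  have hrec : ∀ x : E, ∑ i, (T x) i • (T.symm (PiLp.single 1 i (1 : 𝕜)) : X) = x := by
    intro x
    have h1 : T x = ∑ i, (T x) i • (PiLp.single 1 i (1 : 𝕜) : PiLp 1 fun _ : Fin n => 𝕜) := by
      ext j
      simp [Finset.sum_apply, Pi.single_apply]
    have h2 : T.symm (T x) = ∑ i, (T x) i • T.symm (PiLp.single 1 i (1 : 𝕜)) := by
      conv_lhs => rw [h1]
      simp only [map_sum, map_smul]
    have h3 := congrArg (Subtype.val) h2
    rw [T.symm_apply_apply] at h3
    rw [h3]
    simp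
  have hzero : c = 0 → ∀ v, T.symm v = 0 := by
    intro h v
    have h1 := (T.symm : (PiLp 1 fun _ : Fin n => 𝕜) →L[𝕜] E).le_opNorm v
    rw [← hc, h, zero_mul] at h1
    exact norm_le_zero_iff.1 h1
  refine ⟨{
    size := n
    space := E
    coord := fun x i => if hx : x ∈ E then (c : 𝕜) * T ⟨x, hx⟩ i else 0
    vec := fun i => ((c⁻¹ : ℝ) : 𝕜) • (T.symm (PiLp.single 1 i (1 : 𝕜)) : X)
    sum_coord_le := ?_
    coord_add := ?_
    coord_smul := ?_
    sum_coord_smul_vec := ?_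
    norm_vec_le := ?_ }, rfl⟩
  · intro x
    by_cases hx : x ∈ E
    · simp only [hx, dif_pos, norm_mul, ← Finset.mul_sum]
      have h1 : ∑ i, ‖T ⟨x, hx⟩ i‖ = ‖T ⟨x, hx⟩‖ := by
        rw [PiLp.norm_eq_of_nat 1 (by simp)]; simp
      have h2 := (T : E →L[𝕜] PiLp 1 fun _ : Fin n => 𝕜).le_opNorm ⟨x, hx⟩
      rw [h1, RCLike.norm_ofReal, abs_of_nonneg (norm_nonneg _)]
      calc c * ‖T ⟨x, hx⟩‖ ≤ c * (‖(T : E →L[𝕜] PiLp 1 fun _ : Fin n => 𝕜)‖ * ‖x‖) :=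
            mul_le_mul_of_nonneg_left h2 (norm_nonneg _)
        _ ≤ K * ‖x‖ := by
            rw [← mul_assoc]; exact mul_le_mul_of_nonneg_right hT (norm_nonneg _)
    · simp only [hx, dif_neg, not_false_iff, norm_zero, Finset.sum_const_zero]
      positivity
  · intro x hx y hy
    ext i
    have : (⟨x + y, E.add_mem hx hy⟩ : E) = ⟨x, hx⟩ + ⟨y, hy⟩ := rfl
    simp only [dif_pos hx, dif_pos hy, dif_pos (E.add_mem hx hy), this, map_add, PiLp.add_apply,
      Pi.add_apply, mul_add]
  · intro a x hx
    ext i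
    have : (⟨a • x, E.smul_mem a hx⟩ : E) = a • ⟨x, hx⟩ := rfl
    simp only [dif_pos hx, dif_pos (E.smul_mem a hx), this, map_smul, PiLp.smul_apply, Pi.smul_apply,
      smul_eq_mul, mul_left_comm]
  · intro x hx
    -- The scaling is degenerate only if `T.symm` vanishes, that is, if `E` is trivial.
    by_cases h0 : c = 0
    · have : x = 0 := by
        have := hzero h0 (T ⟨x, hx⟩)
        simpa using this
      simp [h0, this]
    · have := hrec ⟨x, hx⟩
      simp only [hx, dif_pos, smul_smul]
      convert this using 2 with i
      congr 1
      have h0' : (c : 𝕜) ≠ 0 := by exact_mod_cast h0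
      push_cast
      field_simp
  · intro i
    have h1 := (T.symm : (PiLp 1 fun _ : Fin n => 𝕜) →L[𝕜] E).le_opNorm
      (PiLp.single 1 i (1 : 𝕜))
    have h2 : ‖(PiLp.single 1 i (1 : 𝕜) : PiLp 1 fun _ : Fin n => 𝕜)‖ = 1 := by
      simp
    rw [h2, mul_one, ← hc] at h1
    rw [norm_smul, RCLike.norm_ofReal, abs_of_nonneg (by positivity)]
    calc c⁻¹ * ‖(T.symm (PiLp.single 1 i (1 : 𝕜)) : X)‖ ≤ c⁻¹ * c :=
          mul_le_mul_of_nonneg_left h1 (by positivity)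
      _ ≤ 1 := inv_mul_le_one

theorem IsScriptLpSpace.exists_l1Frames (hX : IsScriptLpSpace 𝕜 1 X) :
    ∃ (K : ℝ) (f : Finset X → L1Frame 𝕜 X K), 0 < K ∧ ∀ s : Finset X, (s : Set X) ⊆ (f s).space := by
  obtain ⟨C, -, hC⟩ := hX
  -- The distance is an infimum that need not be attained; the extra `1` leaves room for an actual
  -- isomorphism.
  suffices h : ∀ s : Finset X, ∃ f : L1Frame 𝕜 X (C + 1), (s : Set X) ⊆ f.space by
    choose f hf using h
    exact ⟨C + 1, f, by positivity, hf⟩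
  intro s
  obtain ⟨E, hFE, hE, hd⟩ := hC (Submodule.span 𝕜 (s : Set X)) inferInstance
  have hlt : banachMazurDist 𝕜 E (PiLp 1 fun _ : Fin (Module.finrank 𝕜 E) => 𝕜) <
      ((C + 1 : ℝ≥0) : ℝ≥0∞) :=
    lt_of_le_of_lt hd (by exact_mod_cast lt_add_one C)
  obtain ⟨T, hT⟩ := iInf_lt_iff.1 hlt
  have hT' : ‖(T.symm : (PiLp 1 fun _ : Fin (Module.finrank 𝕜 E) => 𝕜) →L[𝕜] E)‖ *
      ‖(T : E →L[𝕜] PiLp 1 fun _ : Fin (Module.finrank 𝕜 E) => 𝕜)‖ ≤ (C + 1 : ℝ) := by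
    have h1 := hT.le
    simp only [← ofReal_norm] at h1
    rw [← ENNReal.ofReal_mul (norm_nonneg _), ← ENNReal.ofReal_coe_nnreal,
      ENNReal.ofReal_le_ofReal_iff (by positivity)] at h1
    rw [mul_comm]
    exact_mod_cast h1
  obtain ⟨f, hf⟩ := exists_l1Frame_of_equiv T (by positivity) hT'
  exact ⟨f, hf ▸ Submodule.span_le.1 hFE⟩

/-- Coefficients of bounded size on frames define, in the limit along an ultrafilter, a continuous
linear functional. -/
theorem exists_functional_of_weights {K : ℝ} (f : Finset X → L1Frame 𝕜 X K)
    (U : Ultrafilter (Finset X)) (hU : ∀ x, ∀ᶠ s in (U : Filter (Finset X)), x ∈ (f s).space)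
    (g : ∀ s, Fin (f s).size → 𝕜) (hg : ∀ s i, ‖g s i‖ ≤ 1) :
    ∃ φ : StrongDual 𝕜 X, ∀ x,
      Tendsto (fun s => ∑ i, g s i * (f s).coord x i) U (𝓝 (φ x)) := by
  have hb : ∀ (x : X) (s : Finset X), ‖∑ i, g s i * (f s).coord x i‖ ≤ K * ‖x‖ := by
    intro x s
    refine (norm_sum_le _ _).trans (le_trans (Finset.sum_le_sum fun i _ => ?_)
      ((f s).sum_coord_le x))
    rw [norm_mul]
    exact mul_le_of_le_one_left (norm_nonneg _) (hg s i)
  have hlim : ∀ x, ∃ l, Tendsto (fun s => ∑ i, g s i * (f s).coord x i) U (𝓝 l) := by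
    intro x
    obtain ⟨l, -, hl⟩ := (isCompact_closedBall (0 : 𝕜) (K * ‖x‖)).ultrafilter_le_nhds
      (U.map fun s => ∑ i, g s i * (f s).coord x i) (by
        rw [le_principal_iff, Ultrafilter.coe_map]
        exact mem_map.2 (univ_mem' fun s => by simpa using hb x s))
    exact ⟨l, hl⟩
  choose φ hφ using hlim
  -- Coordinates are linear only on the space of the frame, but along `U` that space eventually
  -- contains any given vectors.
  have hadd : ∀ x y, φ (x + y) = φ x + φ y := by
    intro x y
    refine tendsto_nhds_unique (hφ (x + y)) (((hφ x).add (hφ y)).congr' ?_)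
    filter_upwards [hU x, hU y] with s hx hy
    simp [(f s).coord_add x hx y hy, mul_add, Finset.sum_add_distrib]
  have hsmul : ∀ (c : 𝕜) x, φ (c • x) = c * φ x := by
    intro c x
    refine tendsto_nhds_unique (hφ (c • x)) (((hφ x).const_mul c).congr' ?_)
    filter_upwards [hU x] with s hx
    simp [(f s).coord_smul c x hx, Finset.mul_sum, mul_left_comm]
  refine ⟨LinearMap.mkContinuous
    { toFun := φ, map_add' := hadd, map_smul' := fun c x => by simp [hsmul] } K ?_, hφ⟩
  intro x
  exact le_of_tendsto (hφ x).norm (Eventually.of_forall fun s => hb x s)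

end

/-! ### Rosenthal's lemma and almost biorthogonal systems -/

/-- **Rosenthal's lemma**: a matrix of nonnegative numbers with bounded column sums has an infinite
submatrix whose columns have small sums off the diagonal. -/
theorem exists_injective_tsum_offDiag_le {ε : ℝ≥0∞} (hε : ε ≠ ∞) (j : ℕ) :
    ∀ a : ℕ → ℕ → ℝ≥0∞, (∀ n, ∑' m, a m n ≤ j * ε) →
      ∃ f : ℕ → ℕ, Function.Injective f ∧
        ∀ n, ∑' m, (if m = n then 0 else a (f m) (f n)) ≤ ε := by
  induction j with
  | zero =>
    intro a ha
    refine ⟨id, Function.injective_id, fun n => ?_⟩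
    have h0 : ∑' m, a m n = 0 := by simpa using ha n
    have h1 := ENNReal.tsum_eq_zero.1 h0
    simp [h1]
  | succ j ih =>
    intro a ha
    -- `Nat.pair` splits the indices into infinitely many infinite blocks. If no block works, each
    -- has a bad column `q p`. The submatrix on these columns, one per block, omits the off-diagonal
    -- mass of each column within its block, which exceeds `ε`; so its column sums drop by `ε`.
    by_cases hp : ∃ p, ∀ q, ∑' m, (if m = q then 0 else a (Nat.pair p m) (Nat.pair p q)) ≤ ε
    · obtain ⟨p, hp⟩ := hp
      exact ⟨Nat.pair p, fun m n h => (Nat.pair_eq_pair.1 h).2, hp⟩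
    push Not at hp
    choose q hq using hp
    set F : ℕ → ℕ := fun p => Nat.pair p (q p) with hF
    have hFinj : Function.Injective F := fun m n h => (Nat.pair_eq_pair.1 h).1
    obtain ⟨f, hf, hfε⟩ := ih (fun m n => a (F m) (F n)) (by
      intro p
      have h1 : ∑' k, a k (F p) = ∑' p', ∑' m, a (Nat.pair p' m) (F p) := by
        rw [← ENNReal.tsum_prod, ← Nat.pairEquiv.tsum_eq]
        rfl
      have h2 : ∀ p', a (F p') (F p) + (if p' = p then ε else 0) ≤
          ∑' m, a (Nat.pair p' m) (F p) := by
        intro p'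
        split_ifs with h
        · subst h
          rw [ENNReal.tsum_eq_add_tsum_ite (q p')]
          refine add_le_add le_rfl ((hq p').le.trans (le_of_eq ?_))
          exact tsum_congr fun m => by congr
        · rw [add_zero]
          exact ENNReal.le_tsum (q p')
      have h3 := ENNReal.tsum_le_tsum h2
      rw [ENNReal.tsum_add, tsum_ite_eq, ← h1] at h3
      have h4 := h3.trans (ha (F p))
      rw [Nat.cast_succ, add_mul, one_mul] at h4
      exact (ENNReal.add_le_add_iff_right hε).1 h4)
    exact ⟨F ∘ f, hFinj.comp hf, hfε⟩

/-- A bounded sequence of vectors together with a weakly unconditionally summable sequence of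
functionals that is almost biorthogonal to it. -/
structure AlmostBiorthogonal {𝕜 : Type*} [RCLike 𝕜] {X : Type*} [NormedAddCommGroup X]
    [NormedSpace 𝕜 X] (x : ℕ → X) (φ : ℕ → StrongDual 𝕜 X) (K : ℝ) : Prop where
  norm_le : ∀ n, ‖x n‖ ≤ 1
  sum_le : ∀ y (t : Finset ℕ), ∑ m ∈ t, ‖φ m y‖ ≤ K * ‖y‖
  diag : ∀ n, φ n (x n) = 1
  offDiag : ∀ n (t : Finset ℕ), n ∉ t → ∑ m ∈ t, ‖φ m (x n)‖ ≤ 1 / 2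

section

variable {𝕜 : Type*} [RCLike 𝕜] {X : Type*} [NormedAddCommGroup X] [NormedSpace 𝕜 X]

/-- The columns of `‖φ m (x n)‖` have sums at most `K`, so Rosenthal's lemma makes the off-diagonal
sums at most `δ / 2`. Normalizing the diagonal to `1` costs a factor `δ⁻¹`. -/
theorem exists_almostBiorthogonal {x : ℕ → X} {φ : ℕ → StrongDual 𝕜 X} {K δ : ℝ}
    (hx : ∀ n, ‖x n‖ ≤ 1) (hK : 0 ≤ K)
    (hφ : ∀ y (t : Finset ℕ), ∑ m ∈ t, ‖φ m y‖ ≤ K * ‖y‖) (hδ : 0 < δ)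
    (hd : ∀ n, δ ≤ ‖φ n (x n)‖) :
    ∃ (f : ℕ → ℕ) (ψ : ℕ → StrongDual 𝕜 X), AlmostBiorthogonal (x ∘ f) ψ (K / δ) := by
  obtain ⟨j, hj⟩ := exists_nat_ge (K / (δ / 2))
  rw [div_le_iff₀ (by positivity)] at hj
  obtain ⟨f, hf, hfs⟩ := exists_injective_tsum_offDiag_le (ε := ENNReal.ofReal (δ / 2))
    ENNReal.ofReal_ne_top j (fun m n => ENNReal.ofReal ‖φ m (x n)‖) (by
      intro n
      refine ENNReal.summable.tsum_le_of_sum_le fun t => ?_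
      rw [← ENNReal.ofReal_sum_of_nonneg fun _ _ => norm_nonneg _, ← ENNReal.ofReal_natCast,
        ← ENNReal.ofReal_mul (by positivity)]
      refine ENNReal.ofReal_le_ofReal ((hφ _ t).trans (le_trans ?_ hj))
      exact mul_le_of_le_one_right hK (hx n))
  have hne : ∀ n, φ n (x n) ≠ 0 := fun n => norm_pos_iff.1 (hδ.trans_le (hd n))
  have hs : ∀ m y, ‖((φ (f m) (x (f m)))⁻¹ • φ (f m)) y‖ ≤ δ⁻¹ * ‖φ (f m) y‖ := by
    intro m y
    simp only [smul_apply, smul_eq_mul, norm_mul, norm_inv]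
    gcongr
    exact hd _
  refine ⟨f, fun m => (φ (f m) (x (f m)))⁻¹ • φ (f m), fun n => hx _, fun y t => ?_,
    fun n => by simp [hne], fun n t hn => ?_⟩
  · calc _ ≤ ∑ m ∈ t, δ⁻¹ * ‖φ (f m) y‖ := Finset.sum_le_sum fun m _ => hs m y
      _ = δ⁻¹ * ∑ m ∈ t.image f, ‖φ m y‖ := by
        rw [← Finset.mul_sum, Finset.sum_image fun a _ b _ h => hf h]
      _ ≤ δ⁻¹ * (K * ‖y‖) := by gcongr; exact hφ y _
      _ = K / δ * ‖y‖ := by ring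
  · have h1 : ∑ m ∈ t, ‖φ (f m) (x (f n))‖ ≤ δ / 2 := by
      rw [← ENNReal.ofReal_le_ofReal_iff (by positivity),
        ENNReal.ofReal_sum_of_nonneg fun _ _ => norm_nonneg _]
      refine le_trans (le_of_eq ?_) ((ENNReal.sum_le_tsum t).trans (hfs n))
      refine Finset.sum_congr rfl fun m hm => ?_
      rw [if_neg (fun h : m = n => hn (h ▸ hm))]
    calc _ ≤ ∑ m ∈ t, δ⁻¹ * ‖φ (f m) (x (f n))‖ := Finset.sum_le_sum fun m _ => hs m _
      _ = δ⁻¹ * ∑ m ∈ t, ‖φ (f m) (x (f n))‖ := by rw [Finset.mul_sum]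
      _ ≤ δ⁻¹ * (δ / 2) := by gcongr
      _ = 1 / 2 := by field_simp

/-! ### Nonreflexivity and complemented copies of `ℓ₁` -/

namespace AlmostBiorthogonal

variable {x : ℕ → X} {φ : ℕ → StrongDual 𝕜 X} {K : ℝ}

theorem summable_norm (h : AlmostBiorthogonal x φ K) (y : X) : Summable fun m => ‖φ m y‖ :=
  summable_of_sum_le (fun _ => norm_nonneg _) (h.sum_le y)

theorem tsum_norm_le (h : AlmostBiorthogonal x φ K) (y : X) : ∑' m, ‖φ m y‖ ≤ K * ‖y‖ :=
  (h.summable_norm y).tsum_le_of_sum_le (h.sum_le y)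

theorem exists_sum_functional (h : AlmostBiorthogonal x φ K) :
    ∃ ψ : StrongDual 𝕜 X, ∀ y, HasSum (fun m => φ m y) (ψ y) := by
  have hs : ∀ y, Summable fun m => φ m y := fun y => (h.summable_norm y).of_norm
  refine ⟨LinearMap.mkContinuous
    { toFun := fun y => ∑' m, φ m y
      map_add' := fun y z => by simp [(hs y).tsum_add (hs z)]
      map_smul' := fun c y => by simp [tsum_mul_left] } K fun y => ?_, fun y => (hs y).hasSum⟩
  exact (norm_tsum_le_tsum_norm (h.summable_norm y)).trans (h.tsum_norm_le y)

/-- A reflexive space contains no almost biorthogonal system. -/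
theorem not_isReflexiveSpace (h : AlmostBiorthogonal x φ K) {M : Submodule 𝕜 X}
    (hM : ∀ n, x n ∈ M) : ¬ IsReflexiveSpace 𝕜 M := by
  intro hR
  set V : Ultrafilter ℕ := hyperfilter ℕ
  have hlim : ∀ η : StrongDual 𝕜 M, ∃ l, ‖l‖ ≤ ‖η‖ ∧
      Tendsto (fun n => η ⟨x n, hM n⟩) V (𝓝 l) := by
    intro η
    obtain ⟨l, hl, h2⟩ := (isCompact_closedBall (0 : 𝕜) ‖η‖).ultrafilter_le_nhds
      (V.map fun n => η ⟨x n, hM n⟩) (by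
        rw [le_principal_iff, Ultrafilter.coe_map]
        refine mem_map.2 (univ_mem' fun n => ?_)
        simpa using (η.le_opNorm ⟨x n, hM n⟩).trans
          (mul_le_of_le_one_right (norm_nonneg _) (h.norm_le n)))
    exact ⟨l, by simpa using hl, h2⟩
  choose F hFb hF using hlim
  -- Reflexivity represents the limit along the ultrafilter by a vector `y`, a weak limit of the `x
  -- n`.
  obtain ⟨y, hy⟩ := hR (LinearMap.mkContinuous
    { toFun := F
      map_add' := fun η ζ => tendsto_nhds_unique (hF (η + ζ)) ((hF η).add (hF ζ))
      map_smul' := fun c η => tendsto_nhds_unique (hF (c • η)) ((hF η).const_mul c) } 1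
      fun η => by simpa using hFb η)
  have hy' : ∀ η : StrongDual 𝕜 M, Tendsto (fun n => η ⟨x n, hM n⟩) V (𝓝 (η y)) := by
    intro η
    have := congrArg (fun G => G η) hy
    simp only [NormedSpace.dual_def] at this
    rw [this]
    exact hF η
  obtain ⟨ψ, hψ⟩ := h.exists_sum_functional
  -- A tail of the sum has real part at least `1 - 1/2` at every later `x n`, hence also at `y`; yet
  -- the tails at `y` tend to `0`.
  have key : ∀ j n, j ≤ n → 1 / 2 ≤ RCLike.re ((ψ - ∑ m ∈ Finset.range j, φ m) (x n)) := by
    intro j n hjn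
    have h1 : Tendsto (fun k => RCLike.re (∑ m ∈ Finset.Ico j k, φ m (x n))) atTop
        (𝓝 (RCLike.re ((ψ - ∑ m ∈ Finset.range j, φ m) (x n)))) := by
      refine (RCLike.continuous_re.tendsto _).comp ?_
      have h2 := ((hψ (x n)).tendsto_sum_nat).sub_const (∑ m ∈ Finset.range j, φ m (x n))
      simp only [sub_apply, _root_.sum_apply]
      refine h2.congr' ?_
      filter_upwards [eventually_ge_atTop j] with k hk
      rw [Finset.sum_Ico_eq_sub _ hk]
    refine ge_of_tendsto h1 ?_
    filter_upwards [eventually_gt_atTop n] with k hk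
    rw [← Finset.add_sum_erase _ _ (Finset.mem_Ico.2 ⟨hjn, hk⟩), h.diag, map_add, RCLike.one_re]
    have h3 := (RCLike.abs_re_le_norm (∑ m ∈ (Finset.Ico j k).erase n, φ m (x n))).trans
      ((norm_sum_le _ _).trans (h.offDiag n _ (Finset.notMem_erase n _)))
    have := (abs_le.1 h3).1
    linarith
  have hy2 : ∀ j, 1 / 2 ≤ RCLike.re ((ψ - ∑ m ∈ Finset.range j, φ m) (y : X)) := by
    intro j
    have h1 := (RCLike.continuous_re.tendsto _).comp
      (hy' ((ψ - ∑ m ∈ Finset.range j, φ m).comp M.subtypeL))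
    refine ge_of_tendsto h1 ?_
    have : ∀ᶠ n in (V : Filter ℕ), j ≤ n := by
      have h2 : (V : Filter ℕ) ≤ atTop := by
        rw [← Nat.cofinite_eq_atTop]; exact hyperfilter_le_cofinite
      exact h2 (eventually_ge_atTop j)
    filter_upwards [this] with n hn
    exact key j n hn
  have h3 : Tendsto (fun j => RCLike.re ((ψ - ∑ m ∈ Finset.range j, φ m) (y : X))) atTop
      (𝓝 (RCLike.re (ψ (y : X) - ψ (y : X)))) := by
    refine (RCLike.continuous_re.tendsto _).comp ?_
    simpa using ((hψ (y : X)).tendsto_sum_nat).const_sub (ψ (y : X))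
  have := ge_of_tendsto h3 (Eventually.of_forall hy2)
  norm_num at this

/-- The closed span of an almost biorthogonal sequence is a complemented copy of `ℓ₁`. -/
theorem exists_closedComplemented [CompleteSpace X] (h : AlmostBiorthogonal x φ K)
    {M : Submodule 𝕜 X} (hMc : IsClosed (M : Set X)) (hM : ∀ n, x n ∈ M) :
    ∃ N : Submodule 𝕜 X, N ≤ M ∧ IsClosed (N : Set X) ∧ ¬ FiniteDimensional 𝕜 N ∧
      N.ClosedComplemented := by
  have hnorm : ∀ c : lp (fun _ : ℕ => 𝕜) 1, HasSum (fun n => ‖c n‖) ‖c‖ := by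
    intro c
    simpa using lp.hasSum_norm (by simp) c
  have hsum : ∀ c : lp (fun _ : ℕ => 𝕜) 1, Summable fun n => ‖c n • x n‖ := by
    intro c
    refine Summable.of_nonneg_of_le (fun _ => norm_nonneg _) (fun n => ?_) (hnorm c).summable
    rw [norm_smul]
    exact mul_le_of_le_one_right (norm_nonneg _) (h.norm_le n)
  let Ψ : lp (fun _ : ℕ => 𝕜) 1 →L[𝕜] X := LinearMap.mkContinuous
    { toFun := fun c => ∑' n, c n • x n
      map_add' := fun c d => by
        simp [add_smul, (hsum c).of_norm.tsum_add (hsum d).of_norm]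
      map_smul' := fun a c => by
        simp [mul_smul, (hsum c).of_norm.tsum_const_smul] } 1 fun c => by
      rw [one_mul, ← (hnorm c).tsum_eq]
      refine (norm_tsum_le_tsum_norm (hsum c)).trans ((hsum c).tsum_le_tsum (fun n => ?_)
        (hnorm c).summable)
      rw [norm_smul]
      exact mul_le_of_le_one_right (norm_nonneg _) (h.norm_le n)
  have hΨ : ∀ c, HasSum (fun n => c n • x n) (Ψ c) := fun c => (hsum c).of_norm.hasSum
  have hmem : ∀ y, Memℓp (fun n => φ n y) (1 : ℝ≥0∞) := fun y =>
    memℓp_gen (by simpa using h.summable_norm y)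
  let Φ : X →L[𝕜] lp (fun _ : ℕ => 𝕜) 1 := LinearMap.mkContinuous
    { toFun := fun y => ⟨fun n => φ n y, hmem y⟩
      map_add' := fun y z => by ext n; exact map_add (φ n) y z
      map_smul' := fun a y => by ext n; exact map_smul (φ n) a y } K fun y => by
      rw [← (hnorm _).tsum_eq]
      exact h.tsum_norm_le y
  have hΦ : ∀ y n, Φ y n = φ n y := fun _ _ => rfl
  -- An operator on `ℓ₁` is controlled by its values on unit vectors, where `1 - ΦΨ` sees only the
  -- off-diagonal sums. So `ΦΨ` is invertible and `(ΦΨ)⁻¹Φ` is a left inverse of `Ψ`.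
  have hclose : ‖(1 : lp (fun _ : ℕ => 𝕜) 1 →L[𝕜] lp (fun _ : ℕ => 𝕜) 1) - Φ.comp Ψ‖ < 1 := by
    refine lt_of_le_of_lt (ContinuousLinearMap.opNorm_le_bound _ (M := 1 / 2) (by norm_num)
      fun c => ?_) (by norm_num)
    set D := (1 : lp (fun _ : ℕ => 𝕜) 1 →L[𝕜] lp (fun _ : ℕ => 𝕜) 1) - Φ.comp Ψ with hD
    have hDe : ∀ n, ‖D (lp.single 1 n (1 : 𝕜))‖ ≤ 1 / 2 := by
      intro n
      have hx : Ψ (lp.single 1 n (1 : 𝕜)) = x n := by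
        refine (hΨ _).unique ?_
        convert hasSum_ite_eq n (x n) using 2 with m
        by_cases hmn : m = n
        · subst hmn; simp
        · simp [hmn]
      have hDm : ∀ m, D (lp.single 1 n (1 : 𝕜)) m = if m = n then 0 else -φ m (x n) := by
        intro m
        have : D (lp.single 1 n (1 : 𝕜)) m =
            (lp.single 1 n (1 : 𝕜) : lp (fun _ : ℕ => 𝕜) 1) m - φ m (x n) := by
          rw [← hΦ, ← hx]; rfl
        rw [this]
        by_cases hmn : m = n
        · subst hmn; simp [h.diag]
        · simp [hmn]
      refine lp.norm_le_of_forall_sum_le (by simp) (by norm_num) fun t => ?_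
      simp only [ENNReal.toReal_one, Real.rpow_one, hDm]
      refine le_trans (le_of_eq ?_) (h.offDiag n (t.erase n) (Finset.notMem_erase n t))
      by_cases hn : n ∈ t
      · rw [← Finset.add_sum_erase _ _ hn, if_pos rfl, norm_zero, zero_add]
        exact Finset.sum_congr rfl fun m hm => by rw [if_neg (Finset.ne_of_mem_erase hm), norm_neg]
      · rw [Finset.erase_eq_of_notMem hn]
        exact Finset.sum_congr rfl fun m hm => by
          rw [if_neg (fun h : m = n => hn (h ▸ hm)), norm_neg]
    have hDc : HasSum (fun n => c n • D (lp.single 1 n (1 : 𝕜))) (D c) := by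
      have h1 := (lp.hasSum_single (by simp) c).mapL D
      refine h1.congr_fun ?_
      intro n
      rw [← map_smul, ← lp.single_smul, smul_eq_mul, mul_one]
    have hle : ∀ n, ‖c n • D (lp.single 1 n (1 : 𝕜))‖ ≤ ‖c n‖ * (1 / 2) := fun n => by
      rw [norm_smul]
      exact mul_le_mul_of_nonneg_left (hDe n) (norm_nonneg _)
    have hs2 := (hnorm c).mul_right (1 / 2 : ℝ)
    rw [← hDc.tsum_eq, mul_comm]
    exact tsum_of_norm_bounded hs2 hle
  obtain ⟨u, hu⟩ : IsUnit (Φ.comp Ψ) := by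
    have := isUnit_one_sub_of_norm_lt_one hclose
    rwa [sub_sub_cancel] at this
  have hinv : Function.LeftInverse ((↑u⁻¹ : lp (fun _ : ℕ => 𝕜) 1 →L[𝕜] _).comp Φ) Ψ := by
    intro c
    have h1 : (↑u⁻¹ : lp (fun _ : ℕ => 𝕜) 1 →L[𝕜] _) * (Φ.comp Ψ) = 1 := by rw [← hu]; simp
    exact congrArg (fun T => T c) h1
  have hcomp := Ψ.closedComplemented_range_of_leftInverse _ hinv
  refine ⟨Ψ.range, ?_, hcomp.isClosed, fun hfin => ?_, hcomp⟩
  · rintro _ ⟨c, rfl⟩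
    refine hMc.mem_of_tendsto (hΨ c) (Eventually.of_forall fun t => ?_)
    exact M.sum_mem fun n _ => M.smul_mem _ (hM n)
  · have hinj : Function.Injective Ψ := hinv.injective
    have hli : LinearIndependent 𝕜 (fun n : ℕ => (lp.single 1 n (1 : 𝕜) : lp (fun _ : ℕ => 𝕜) 1)) := by
      rw [linearIndependent_iff']
      intro s g hg i hi
      have h1 := congrArg (lp.evalCLM 𝕜 (fun _ : ℕ => 𝕜) 1 i) hg
      rw [map_sum] at h1
      have h2 : ∀ n, lp.evalCLM 𝕜 (fun _ : ℕ => 𝕜) 1 i (lp.single 1 n (1 : 𝕜)) =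
          if i = n then 1 else 0 := fun n => by
        change (lp.single 1 n (1 : 𝕜) : lp (fun _ : ℕ => 𝕜) 1) i = _
        simp [Pi.single_apply]
      simpa [h2, hi] using h1
    have hfin2 : FiniteDimensional 𝕜 (lp (fun _ : ℕ => 𝕜) 1) :=
      FiniteDimensional.of_injective (Ψ : lp (fun _ : ℕ => 𝕜) 1 →ₗ[𝕜] X).rangeRestrict
        (fun a b hab => hinj (congrArg Subtype.val hab))
    exact not_finite_iff_infinite.2 inferInstance hli.finite

end AlmostBiorthogonal
end

/-! ### Domination and extraction of disjoint pieces -/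

section

variable {𝕜 : Type*} [RCLike 𝕜] {X : Type*} [NormedAddCommGroup X] [NormedSpace 𝕜 X]

/-- A set `S` is dominated if, up to an arbitrarily small error in the `ℓ₁`-norm, all coordinates of
its elements lie below a common multiple of those of finitely many vectors. -/
def L1Frame.Dominated {K : ℝ} (f : Finset X → L1Frame 𝕜 X K) (U : Ultrafilter (Finset X))
    (S : Set X) : Prop :=
  ∀ ε : ℝ, 0 < ε → ∃ (t : Finset X) (C : ℝ), 0 ≤ C ∧ ∀ x ∈ S, ∀ᶠ s in (U : Filter (Finset X)),
    ∑ i, max (‖(f s).coord x i‖ - C * ∑ y ∈ t, ‖(f s).coord y i‖) 0 ≤ ε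

theorem RCLike.exists_norm_le_one_mul_eq_norm (z : 𝕜) : ∃ a : 𝕜, ‖a‖ ≤ 1 ∧ a * z = (‖z‖ : 𝕜) := by
  by_cases hz : z = 0
  · exact ⟨0, by simp, by simp [hz]⟩
  · have hz' : (‖z‖ : 𝕜) ≠ 0 := by simpa using hz
    refine ⟨(starRingEnd 𝕜) z / ‖z‖, ?_, ?_⟩
    · simp [hz]
    · rw [div_mul_eq_mul_div, RCLike.conj_mul, pow_two, mul_div_assoc, div_self hz', mul_one]

/-- A bounded set that is not dominated contains a sequence on which some weakly unconditionally
summable sequence of functionals is bounded away from zero. -/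
theorem L1Frame.exists_of_not_dominated {K : ℝ} (hK : 0 < K) (f : Finset X → L1Frame 𝕜 X K)
    (U : Ultrafilter (Finset X)) (hU : ∀ x, ∀ᶠ s in (U : Filter (Finset X)), x ∈ (f s).space)
    {S : Set X} (hS : ∀ x ∈ S, ‖x‖ ≤ 1) (hnd : ¬ L1Frame.Dominated f U S) :
    ∃ (x : ℕ → X) (φ : ℕ → StrongDual 𝕜 X) (δ : ℝ), 0 < δ ∧ (∀ n, x n ∈ S) ∧
      (∀ y (t : Finset ℕ), ∑ m ∈ t, ‖φ m y‖ ≤ K * ‖y‖) ∧ ∀ n, δ ≤ ‖φ n (x n)‖ := by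
  classical
  unfold L1Frame.Dominated at hnd
  push Not at hnd
  obtain ⟨ε, hε, h⟩ := hnd
  -- Chosen so that `K / C j = (ε / 4) * 2⁻ʲ`; the total loss over all `j` is then at most `ε / 2`.
  set C : ℕ → ℝ := fun n => K * 2 ^ (n + 2) / ε with hC
  have hCpos : ∀ n, 0 < C n := fun n => by positivity
  have h' : ∀ (t : Finset X) (n : ℕ), ∃ x ∈ S, ∀ᶠ s in (U : Filter (Finset X)),
      ε < ∑ i, max (‖(f s).coord x i‖ - C n * ∑ y ∈ t, ‖(f s).coord y i‖) 0 := by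
    intro t n
    obtain ⟨x, hx, hxs⟩ := h t (C n) (hCpos n).le
    exact ⟨x, hx, hxs⟩
  choose g hgS hg using h'
  -- `L n` collects the vectors chosen before stage `n`.
  let L : ℕ → Finset X := fun n => Nat.rec ∅ (fun n t => insert (g t n) t) n
  have hL : ∀ n, L (n + 1) = insert (g (L n) n) (L n) := fun n => rfl
  set x : ℕ → X := fun n => g (L n) n with hx
  have hxS : ∀ n, x n ∈ S := fun n => hgS _ _
  have hxL : ∀ n j, j < n → x j ∈ L n := by
    intro n
    induction n with
    | zero => intro j hj; omega
    | succ n ih =>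
      intro j hj
      rw [hL]
      rcases Nat.lt_succ_iff_lt_or_eq.1 hj with h1 | h1
      · exact Finset.mem_insert_of_mem (ih j h1)
      · subst h1; exact Finset.mem_insert_self _ _
  -- `A s n` is where `x n` outweighs all its predecessors. `B s n` keeps the coordinates for which
  -- `n` is the last such index, so the sets `B s n` are disjoint in `n`.
  let A : ∀ s : Finset X, ℕ → Fin (f s).size → Prop := fun s n i =>
    C n * ∑ y ∈ L n, ‖(f s).coord y i‖ < ‖(f s).coord (x n) i‖
  let B : ∀ s : Finset X, ℕ → Fin (f s).size → Prop := fun s n i =>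
    A s n i ∧ ∀ j, n < j → ¬ A s j i
  have hB : ∀ s i m n, B s m i → B s n i → m = n := by
    intro s i m n hm hn
    rcases lt_trichotomy m n with h1 | h1 | h1
    · exact absurd hn.1 (hm.2 n h1)
    · exact h1
    · exact absurd hm.1 (hn.2 m h1)
  choose sg hsg1 hsg2 using RCLike.exists_norm_le_one_mul_eq_norm (𝕜 := 𝕜)
  let w : ℕ → ∀ s : Finset X, Fin (f s).size → 𝕜 := fun n s i =>
    if B s n i then sg ((f s).coord (x n) i) else 0
  have hw : ∀ n s i, ‖w n s i‖ ≤ 1 := by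
    intro n s i
    simp only [w]
    split_ifs
    · exact hsg1 _
    · simp
  have hwsum : ∀ s i (t : Finset ℕ), ∑ n ∈ t, ‖w n s i‖ ≤ 1 := by
    intro s i t
    by_cases hex : ∃ n ∈ t, B s n i
    · obtain ⟨n, hn, hBn⟩ := hex
      rw [Finset.sum_eq_single_of_mem n hn]
      · exact hw n s i
      · intro m _ hmn
        simp only [w]
        rw [if_neg fun hBm => hmn (hB s i m n hBm hBn), norm_zero]
    · rw [Finset.sum_eq_zero]
      · exact zero_le_one
      · intro n hn
        simp only [w]
        rw [if_neg fun hBn => hex ⟨n, hn, hBn⟩, norm_zero]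
  choose φ hφ using fun n => exists_functional_of_weights f U hU (w n) (hw n)
  refine ⟨x, φ, ε / 2, by positivity, hxS, fun y t => ?_, fun n => ?_⟩
  · refine le_of_tendsto (tendsto_finsetSum t fun n _ => (hφ n y).norm)
      (Eventually.of_forall fun s => ?_)
    calc ∑ n ∈ t, ‖∑ i, w n s i * (f s).coord y i‖
        ≤ ∑ n ∈ t, ∑ i, ‖w n s i‖ * ‖(f s).coord y i‖ :=
          Finset.sum_le_sum fun n _ => (norm_sum_le _ _).trans_eq (by simp)
      _ = ∑ i, (∑ n ∈ t, ‖w n s i‖) * ‖(f s).coord y i‖ := by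
          rw [Finset.sum_comm]; simp [Finset.sum_mul]
      _ ≤ ∑ i, ‖(f s).coord y i‖ := Finset.sum_le_sum fun i _ =>
          mul_le_of_le_one_left (norm_nonneg _) (hwsum s i t)
      _ ≤ K * ‖y‖ := (f s).sum_coord_le y
  · refine ge_of_tendsto (hφ n (x n)).norm ?_
    filter_upwards [hg (L n) n] with s hs
    have h1 : ∑ i, w n s i * (f s).coord (x n) i =
        ((∑ i, if B s n i then ‖(f s).coord (x n) i‖ else 0 : ℝ) : 𝕜) := by
      push_cast
      refine Finset.sum_congr rfl fun i _ => ?_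
      simp only [w]
      split_ifs
      · exact hsg2 _
      · simp
    rw [h1, RCLike.norm_ofReal]
    refine le_trans ?_ (le_abs_self _)
    -- On `A s n` outside `B s n` a later `x j` outweighs `x n` by the factor `C j`, so the
    -- discarded mass of `x n` is charged to `(C j)⁻¹ * ‖coord (x j) i‖`.
    have h2 : ∀ i, ∃ j, A s n i → ¬ B s n i → n < j ∧ A s j i := by
      intro i
      by_cases hAB : A s n i ∧ ¬ B s n i
      · have : ∃ j, n < j ∧ A s j i := by
          by_contra hcon
          push Not at hcon
          exact hAB.2 ⟨hAB.1, hcon⟩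
        obtain ⟨j, hj⟩ := this
        exact ⟨j, fun _ _ => hj⟩
      · exact ⟨0, fun h3 h4 => absurd ⟨h3, h4⟩ hAB⟩
    choose jj hjj using h2
    set J := Finset.univ.sup jj + 1 with hJ
    have h3 : ∀ i, max (‖(f s).coord (x n) i‖ - C n * ∑ y ∈ L n, ‖(f s).coord y i‖) 0 ≤
        (if B s n i then ‖(f s).coord (x n) i‖ else 0) +
          ∑ j ∈ Finset.range J, (C j)⁻¹ * ‖(f s).coord (x j) i‖ := by
      intro i
      have hnn : ∀ j ∈ Finset.range J, 0 ≤ (C j)⁻¹ * ‖(f s).coord (x j) i‖ := fun j _ =>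
        mul_nonneg (inv_nonneg.2 (hCpos j).le) (norm_nonneg _)
      have hS0 := Finset.sum_nonneg hnn
      have hLn : 0 ≤ C n * ∑ y ∈ L n, ‖(f s).coord y i‖ :=
        mul_nonneg (hCpos n).le (Finset.sum_nonneg fun _ _ => norm_nonneg _)
      by_cases hBi : B s n i
      · rw [if_pos hBi]
        exact max_le (by linarith) (by positivity)
      · rw [if_neg hBi, zero_add]
        by_cases hAi : A s n i
        · obtain ⟨hj1, hj2⟩ := hjj i hAi hBi
          refine max_le ?_ hS0
          have h4 : C (jj i) * ‖(f s).coord (x n) i‖ ≤ ‖(f s).coord (x (jj i)) i‖ := by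
            refine le_trans (mul_le_mul_of_nonneg_left ?_ (hCpos _).le) hj2.le
            exact Finset.single_le_sum (f := fun y => ‖(f s).coord y i‖)
              (fun _ _ => norm_nonneg _) (hxL _ _ hj1)
          have h5 : ‖(f s).coord (x n) i‖ ≤ (C (jj i))⁻¹ * ‖(f s).coord (x (jj i)) i‖ := by
            rw [inv_mul_eq_div, le_div_iff₀ (hCpos _), mul_comm]
            exact h4
          have h6 : jj i ∈ Finset.range J := by
            rw [Finset.mem_range, hJ, Nat.lt_succ_iff]
            exact Finset.le_sup (f := jj) (Finset.mem_univ i)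
          have h7 := Finset.single_le_sum hnn h6
          linarith
        · refine max_le ?_ hS0
          have := not_lt.1 hAi
          linarith
    have h4 : ∑ i, ∑ j ∈ Finset.range J, (C j)⁻¹ * ‖(f s).coord (x j) i‖ ≤ ε / 2 := by
      rw [Finset.sum_comm]
      calc ∑ j ∈ Finset.range J, ∑ i, (C j)⁻¹ * ‖(f s).coord (x j) i‖
          ≤ ∑ j ∈ Finset.range J, ε / 4 * (1 / 2) ^ j := by
            refine Finset.sum_le_sum fun j _ => ?_
            rw [← Finset.mul_sum]
            have h5 : ∑ i, ‖(f s).coord (x j) i‖ ≤ K :=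
              ((f s).sum_coord_le _).trans (mul_le_of_le_one_right hK.le (hS _ (hxS j)))
            calc (C j)⁻¹ * ∑ i, ‖(f s).coord (x j) i‖ ≤ (C j)⁻¹ * K :=
                  mul_le_mul_of_nonneg_left h5 (inv_nonneg.2 (hCpos j).le)
              _ = ε / 4 * (1 / 2) ^ j := by
                  simp only [hC, pow_add, one_div, inv_pow]
                  field_simp
                  norm_num
        _ = ε / 4 * ∑ j ∈ Finset.range J, (1 / 2 : ℝ) ^ j := by rw [Finset.mul_sum]
        _ ≤ ε / 4 * 2 := by gcongr; exact sum_geometric_two_le J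
        _ = ε / 2 := by ring
    have h5 := Finset.sum_le_sum fun i (_ : i ∈ Finset.univ) => h3 i
    rw [Finset.sum_add_distrib] at h5
    have h6 : ε < ∑ i, max (‖(f s).coord (x n) i‖ - C n * ∑ y ∈ L n, ‖(f s).coord y i‖) 0 := hs
    linarith

/-- Radial shrinking to the disc of radius `r`. It turns the excess in `L1Frame.Dominated` into the
error of an actual approximation lying below the weight. -/
theorem RCLike.exists_truncation (z : 𝕜) {r : ℝ} (hr : 0 ≤ r) :
    ∃ a : 𝕜, ‖a‖ ≤ r ∧ ‖z - a‖ = max (‖z‖ - r) 0 := by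
  by_cases h : ‖z‖ ≤ r
  · exact ⟨z, h, by simp [h]⟩
  · push Not at h
    have hz : 0 < ‖z‖ := hr.trans_lt h
    have hz' : (‖z‖ : 𝕜) ≠ 0 := by exact_mod_cast hz.ne'
    refine ⟨((r / ‖z‖ : ℝ) : 𝕜) * z, ?_, ?_⟩
    · rw [norm_mul, RCLike.norm_ofReal, abs_of_nonneg (by positivity), div_mul_cancel₀ _ hz.ne']
    · have : z - ((r / ‖z‖ : ℝ) : 𝕜) * z = ((1 - r / ‖z‖ : ℝ) : 𝕜) * z := by push_cast; ring
      rw [this, norm_mul, RCLike.norm_ofReal, abs_of_nonneg (by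
        rw [sub_nonneg, div_le_one hz]; exact h.le), max_eq_left (by linarith), sub_mul,
        div_mul_cancel₀ _ hz.ne', one_mul]

end

/-! ### Complemented subspaces with dominated ball are finite-dimensional -/

section

variable {𝕜 : Type*} [RCLike 𝕜]

/-- A space of functions on which the supremum norm and the `L₁`-norm of a finite measure `w` are
both equivalent to a given norm has bounded dimension. -/
theorem finrank_le_of_sup_le_of_le_sum {F : Type*} [NormedAddCommGroup F] [NormedSpace 𝕜 F]
    {n : ℕ} (A : F →ₗ[𝕜] Fin n → 𝕜) {w : Fin n → ℝ} (hw : ∀ i, 0 ≤ w i) {W C c : ℝ}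
    (hW : ∑ i, w i ≤ W) (hC : 0 ≤ C) (hc : 0 ≤ c) (hA : ∀ x i, ‖A x i‖ ≤ C * w i * ‖x‖)
    (hx : ∀ x, ‖x‖ ≤ c * ∑ i, ‖A x i‖) :
    (Module.finrank 𝕜 F : ℝ) ≤ (C * c * W) ^ 2 := by
  have hW0 : 0 ≤ W := (Finset.sum_nonneg fun i _ => hw i).trans hW
  -- If `A x` is a measure with density `A x / w`, this is the `L₂(w)` embedding of the density.
  -- Where `w i = 0` the hypothesis forces `A x i = 0`, so the default value of the inverse is
  -- harmless.
  let B : F →ₗ[𝕜] EuclideanSpace 𝕜 (Fin n) :=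
    { toFun := fun x => WithLp.toLp 2 fun i => (((√(w i))⁻¹ : ℝ) : 𝕜) * A x i
      map_add' := fun x y => by ext i; simp [mul_add]
      map_smul' := fun a x => by ext i; simp [mul_left_comm] }
  have hBi : ∀ x i, ‖B x i‖ = (√(w i))⁻¹ * ‖A x i‖ := by
    intro x i
    change ‖(((√(w i))⁻¹ : ℝ) : 𝕜) * A x i‖ = _
    rw [norm_mul, RCLike.norm_ofReal, abs_of_nonneg (by positivity)]
  have hAB : ∀ x i, ‖A x i‖ = √(w i) * ‖B x i‖ := by
    intro x i
    rw [hBi]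
    rcases (hw i).eq_or_lt with h | h
    · have : ‖A x i‖ ≤ 0 := by simpa [← h] using hA x i
      have h0 : ‖A x i‖ = 0 := le_antisymm this (norm_nonneg _)
      simp [h0]
    · rw [mul_inv_cancel_left₀ (Real.sqrt_pos.2 h).ne']
  have hxB : ∀ x, ‖x‖ ≤ c * (√W * ‖B x‖) := by
    intro x
    refine (hx x).trans (mul_le_mul_of_nonneg_left ?_ hc)
    simp only [hAB]
    refine (Real.sum_mul_le_sqrt_mul_sqrt _ _ _).trans ?_
    rw [EuclideanSpace.norm_eq]
    gcongr
    simpa [Real.sq_sqrt (hw _)] using hW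
  have hinj : Function.Injective B := by
    rw [← LinearMap.ker_eq_bot, LinearMap.ker_eq_bot']
    intro x h0
    have := hxB x
    rw [h0, norm_zero, mul_zero, mul_zero] at this
    exact norm_le_zero_iff.1 this
  have hBle : ∀ x i, ‖B x i‖ ≤ √(w i) * (C * c * √W) * ‖B x‖ := by
    intro x i
    rw [hBi]
    have h1 : (√(w i))⁻¹ * w i = √(w i) := by
      rw [inv_mul_eq_div, Real.div_sqrt]
    calc (√(w i))⁻¹ * ‖A x i‖ ≤ (√(w i))⁻¹ * (C * w i * (c * (√W * ‖B x‖))) := by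
          gcongr
          refine (hA x i).trans ?_
          exact mul_le_mul_of_nonneg_left (hxB x) (mul_nonneg hC (hw i))
      _ = ((√(w i))⁻¹ * w i) * (C * c * √W) * ‖B x‖ := by ring
      _ = _ := by rw [h1]
  rw [← LinearMap.finrank_range_of_inj hinj]
  let b := stdOrthonormalBasis 𝕜 (LinearMap.range B)
  -- Apply the sup bound `hBle` at coordinate `i` to the vector with coefficients `conj (b k i)`:
  -- its value there is the sum `t` and its norm is `√t`. Summing over `i` gives the dimension.
  have key : ∀ i, ∑ k, ‖(b k : EuclideanSpace 𝕜 (Fin n)) i‖ ^ 2 ≤ (C * c * √W) ^ 2 * w i := by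
    intro i
    set t : ℝ := ∑ k, ‖(b k : EuclideanSpace 𝕜 (Fin n)) i‖ ^ 2 with ht
    have ht0 : 0 ≤ t := Finset.sum_nonneg fun _ _ => by positivity
    set a : EuclideanSpace 𝕜 (Fin (Module.finrank 𝕜 (LinearMap.range B))) :=
      WithLp.toLp 2 fun k => (starRingEnd 𝕜) ((b k : EuclideanSpace 𝕜 (Fin n)) i) with ha
    have h1 : ‖b.repr.symm a‖ = √t := by
      rw [LinearIsometryEquiv.norm_map, EuclideanSpace.norm_eq]
      simp [ha, ht]
    have h2 : ((b.repr.symm a : LinearMap.range B) : EuclideanSpace 𝕜 (Fin n)) i = (t : 𝕜) := by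
      rw [← b.sum_repr_symm]
      simp [ha, ht, RCLike.conj_mul]
    obtain ⟨x, hx⟩ := (b.repr.symm a).2
    have h3 := hBle x i
    rw [hx, h2, RCLike.norm_ofReal, abs_of_nonneg ht0, ← Submodule.coe_norm, h1] at h3
    rcases ht0.eq_or_lt with h0 | h0
    · rw [← h0]; exact mul_nonneg (sq_nonneg _) (hw i)
    · have h4 : √t ≤ √(w i) * (C * c * √W) := by
        have h5 : √t * √t ≤ √(w i) * (C * c * √W) * √t := by
          rwa [Real.mul_self_sqrt ht0]
        exact le_of_mul_le_mul_right h5 (Real.sqrt_pos.2 h0)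
      calc t = √t ^ 2 := (Real.sq_sqrt ht0).symm
        _ ≤ (√(w i) * (C * c * √W)) ^ 2 := by gcongr
        _ = (C * c * √W) ^ 2 * w i := by rw [mul_pow, Real.sq_sqrt (hw i), mul_comm]
  have hone : ∀ k, ∑ i, ‖(b k : EuclideanSpace 𝕜 (Fin n)) i‖ ^ 2 = 1 := by
    intro k
    rw [← EuclideanSpace.norm_sq_eq, ← Submodule.coe_norm, b.orthonormal.1 k, one_pow]
  calc (Module.finrank 𝕜 (LinearMap.range B) : ℝ)
      = ∑ k, ∑ i, ‖(b k : EuclideanSpace 𝕜 (Fin n)) i‖ ^ 2 := by simp [hone]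
    _ = ∑ i, ∑ k, ‖(b k : EuclideanSpace 𝕜 (Fin n)) i‖ ^ 2 := Finset.sum_comm
    _ ≤ ∑ i, (C * c * √W) ^ 2 * w i := Finset.sum_le_sum fun i _ => key i
    _ = (C * c * √W) ^ 2 * ∑ i, w i := by rw [Finset.mul_sum]
    _ ≤ (C * c * √W) ^ 2 * W := by gcongr
    _ = (C * c * W) ^ 2 := by rw [mul_pow, Real.sq_sqrt hW0]; ring

namespace L1Frame

variable {X : Type*} [NormedAddCommGroup X] [NormedSpace 𝕜 X] {K : ℝ}

theorem coord_zero (f : L1Frame 𝕜 X K) : f.coord 0 = 0 := by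
  simpa using f.coord_smul 0 0 f.space.zero_mem

theorem coord_sum {ι : Type*} (f : L1Frame 𝕜 X K) (t : Finset ι) (a : ι → 𝕜) {v : ι → X}
    (hv : ∀ i, v i ∈ f.space) : f.coord (∑ i ∈ t, a i • v i) = ∑ i ∈ t, a i • f.coord (v i) := by
  classical
  induction t using Finset.induction_on with
  | empty => simp [f.coord_zero]
  | insert i t hi ih =>
    rw [Finset.sum_insert hi, Finset.sum_insert hi, f.coord_add _ (f.space.smul_mem _ (hv i)) _
      (f.space.sum_mem fun j _ => f.space.smul_mem _ (hv j)), ih, f.coord_smul _ _ (hv i)]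

theorem norm_le_sum_coord (f : L1Frame 𝕜 X K) {x : X} (hx : x ∈ f.space) :
    ‖x‖ ≤ ∑ i, ‖f.coord x i‖ := by
  conv_lhs => rw [← f.sum_coord_smul_vec x hx]
  refine (norm_sum_le _ _).trans (Finset.sum_le_sum fun i _ => ?_)
  rw [norm_smul]
  exact mul_le_of_le_one_right (norm_nonneg _) (f.norm_vec_le i)

/-- The total mass of the dominating weight is bounded independently of the frame, which makes the
later dimension and energy bounds uniform. -/
theorem sum_weight_le (f : L1Frame 𝕜 X K) (t : Finset X) {C : ℝ} (hC : 0 ≤ C) :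
    ∑ i, C * ∑ y ∈ t, ‖f.coord y i‖ ≤ C * (K * ∑ y ∈ t, ‖y‖) := by
  have h : K * ∑ y ∈ t, ‖y‖ = ∑ y ∈ t, K * ‖y‖ := Finset.mul_sum _ _ _
  rw [← Finset.mul_sum, Finset.sum_comm, h]
  exact mul_le_mul_of_nonneg_left (Finset.sum_le_sum fun y _ => f.sum_coord_le y) hC

/-- A complemented subspace whose unit ball is dominated is finite-dimensional. -/
theorem finiteDimensional_of_dominated (hK : 0 < K) (f : Finset X → L1Frame 𝕜 X K)
    (U : Ultrafilter (Finset X)) (hU : ∀ x, ∀ᶠ s in (U : Filter (Finset X)), x ∈ (f s).space)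
    {N : Submodule 𝕜 X} (hN : N.ClosedComplemented)
    (hd : Dominated f U {x | x ∈ N ∧ ‖x‖ ≤ 1}) : FiniteDimensional 𝕜 N := by
  classical
  obtain ⟨P, hP⟩ := hN
  set R : ℝ := ‖P‖ + 1 with hR
  have hR0 : 0 < R := by positivity
  obtain ⟨t, C, hC, ht⟩ := hd (1 / (2 * (K * R))) (by positivity)
  set W : ℝ := C * (K * ∑ y ∈ t, ‖y‖) with hW
  obtain ⟨d, hd⟩ := exists_nat_ge ((K * R * 2 * W) ^ 2)
  suffices h : Module.rank 𝕜 N ≤ d by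
    exact Module.rank_lt_aleph0_iff.1 (h.trans_lt (Cardinal.natCast_lt_aleph0))
  refine rank_le fun v hv => ?_
  set F : Submodule 𝕜 N := Submodule.span 𝕜 (v : Set N) with hF
  have hcard : Module.finrank 𝕜 F = v.card := finrank_span_finset_eq_card hv
  have hFE : ∀ᶠ s in (U : Filter (Finset X)), F ≤ (f s).space.comap N.subtype := by
    have : ∀ᶠ s in (U : Filter (Finset X)), ∀ x ∈ v, (x : X) ∈ (f s).space :=
      (Finset.eventually_all v).2 fun x _ => hU x
    filter_upwards [this] with s hs
    exact Submodule.span_le.2 fun x hx => hs x hx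
  obtain ⟨s, hs⟩ := hFE.exists
  -- Since `P` fixes `F`, each `x` in `F` is the combination of these vectors of `N` with its own
  -- `ℓ₁` coordinates. Only finitely many vectors therefore have to be truncated.
  set y : Fin (f s).size → X := fun i => ((P ((f s).vec i) : N) : X) with hy
  have hyS : ∀ i, ((R⁻¹ : ℝ) : 𝕜) • y i ∈ {x | x ∈ N ∧ ‖x‖ ≤ 1} := by
    intro i
    refine ⟨N.smul_mem _ (P ((f s).vec i)).2, ?_⟩
    rw [norm_smul, RCLike.norm_ofReal, abs_of_nonneg (by positivity), inv_mul_le_one₀ hR0]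
    have h1 : ‖P ((f s).vec i)‖ ≤ ‖P‖ * 1 :=
      (P.le_opNorm _).trans (mul_le_mul_of_nonneg_left ((f s).norm_vec_le i) (norm_nonneg _))
    have h2 : ‖y i‖ = ‖P ((f s).vec i)‖ := rfl
    linarith
  -- A second frame is needed: domination holds only eventually for each given vector, and the `y i`
  -- depend on `s`.
  obtain ⟨s', hs'F, hs'y, hs'⟩ := (hFE.and ((eventually_all.2 fun i => hU (y i)).and
    (eventually_all.2 fun i => ht _ (hyS i)))).exists
  set w : Fin (f s').size → ℝ := fun l => C * ∑ y ∈ t, ‖(f s').coord y l‖ with hw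
  have hw0 : ∀ l, 0 ≤ w l := fun l =>
    mul_nonneg hC (Finset.sum_nonneg fun _ _ => norm_nonneg _)
  have htr : ∀ i l, ∃ a : 𝕜, ‖a‖ ≤ w l ∧
      ‖(f s').coord (((R⁻¹ : ℝ) : 𝕜) • y i) l - a‖ =
        max (‖(f s').coord (((R⁻¹ : ℝ) : 𝕜) • y i) l‖ - w l) 0 :=
    fun i l => RCLike.exists_truncation _ (hw0 l)
  choose a ha1 ha2 using htr
  have herr : ∀ i, ∑ l, ‖(f s').coord (y i) l - (R : 𝕜) * a i l‖ ≤ 1 / (2 * K) := by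
    intro i
    have h1 : ∀ l, ‖(f s').coord (y i) l - (R : 𝕜) * a i l‖ =
        R * max (‖(f s').coord (((R⁻¹ : ℝ) : 𝕜) • y i) l‖ - w l) 0 := by
      intro l
      rw [← ha2]
      have hRne : (R : 𝕜) ≠ 0 := by exact_mod_cast hR0.ne'
      have h2 : (f s').coord (y i) l - (R : 𝕜) * a i l =
          (R : 𝕜) * ((f s').coord (((R⁻¹ : ℝ) : 𝕜) • y i) l - a i l) := by
        rw [(f s').coord_smul _ _ (hs'y i), Pi.smul_apply, smul_eq_mul, mul_sub]
        push_cast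
        rw [mul_inv_cancel_left₀ hRne]
      rw [h2, norm_mul, RCLike.norm_ofReal, abs_of_pos hR0]
    simp only [h1, ← Finset.mul_sum]
    calc _ ≤ R * (1 / (2 * (K * R))) := mul_le_mul_of_nonneg_left (hs' i) hR0.le
      _ = 1 / (2 * K) := by field_simp
  -- Truncation is not linear; extending the truncated coordinates of the `y i` linearly keeps the
  -- bound by the weight and costs at most `‖x‖ / 2` in `ℓ₁`.
  let A : F →ₗ[𝕜] Fin (f s').size → 𝕜 :=
    { toFun := fun x l => ∑ i, (f s).coord ((x : N) : X) i * ((R : 𝕜) * a i l)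
      map_add' := fun x z => by
        ext l
        have h1 := (f s).coord_add _ (hs x.2) _ (hs z.2)
        simp only [Submodule.subtype_apply] at h1
        simp [h1, add_mul, Finset.sum_add_distrib]
      map_smul' := fun c x => by
        ext l
        have h1 := (f s).coord_smul c _ (hs x.2)
        simp only [Submodule.subtype_apply] at h1
        simp [h1, mul_assoc, Finset.mul_sum] }
  have hA : ∀ x l, A x l = ∑ i, (f s).coord ((x : N) : X) i * ((R : 𝕜) * a i l) :=
    fun _ _ => rfl
  have hmain := finrank_le_of_sup_le_of_le_sum A hw0 (C := K * R) (c := 2)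
    ((f s').sum_weight_le t hC) (by positivity) (by norm_num) (fun x l => ?_) (fun x => ?_)
  · rw [hcard] at hmain
    exact_mod_cast hmain.trans hd
  · rw [hA]
    calc _ ≤ ∑ i, ‖(f s).coord ((x : N) : X) i‖ * (R * w l) := by
          refine (norm_sum_le _ _).trans (Finset.sum_le_sum fun i _ => ?_)
          rw [norm_mul, norm_mul, RCLike.norm_ofReal, abs_of_pos hR0]
          gcongr
          exact ha1 i l
      _ = (∑ i, ‖(f s).coord ((x : N) : X) i‖) * (R * w l) := by rw [Finset.sum_mul]
      _ ≤ (K * ‖x‖) * (R * w l) :=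
          mul_le_mul_of_nonneg_right ((f s).sum_coord_le _) (mul_nonneg hR0.le (hw0 l))
      _ = K * R * w l * ‖x‖ := by ring
  · have hxs : ((x : N) : X) ∈ (f s).space := hs x.2
    have hxs' : ((x : N) : X) ∈ (f s').space := hs'F x.2
    have hrep : ((x : N) : X) = ∑ i, (f s).coord ((x : N) : X) i • y i := by
      have h1 := congrArg (fun z => ((P z : N) : X)) ((f s).sum_coord_smul_vec _ hxs)
      simp only [map_sum, map_smul, hP] at h1
      refine h1.symm.trans ?_
      simp [hy]
    have hco : ∀ l, (f s').coord ((x : N) : X) l =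
        ∑ i, (f s).coord ((x : N) : X) i * (f s').coord (y i) l := by
      intro l
      conv_lhs => rw [hrep, (f s').coord_sum _ _ hs'y]
      simp
    have hdiff : ∑ l, ‖(f s').coord ((x : N) : X) l - A x l‖ ≤ ‖x‖ / 2 := by
      calc _ ≤ ∑ l, ∑ i, ‖(f s).coord ((x : N) : X) i‖ *
            ‖(f s').coord (y i) l - (R : 𝕜) * a i l‖ := by
            refine Finset.sum_le_sum fun l _ => ?_
            rw [hco, hA, ← Finset.sum_sub_distrib]
            refine (norm_sum_le _ _).trans (Finset.sum_le_sum fun i _ => ?_)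
            rw [← mul_sub, norm_mul]
        _ = ∑ i, ‖(f s).coord ((x : N) : X) i‖ *
            ∑ l, ‖(f s').coord (y i) l - (R : 𝕜) * a i l‖ := by
            rw [Finset.sum_comm]
            simp [Finset.mul_sum]
        _ ≤ ∑ i, ‖(f s).coord ((x : N) : X) i‖ * (1 / (2 * K)) := by
            gcongr with i
            exact herr i
        _ = (∑ i, ‖(f s).coord ((x : N) : X) i‖) * (1 / (2 * K)) := by rw [Finset.sum_mul]
        _ ≤ (K * ‖x‖) * (1 / (2 * K)) :=
            mul_le_mul_of_nonneg_right ((f s).sum_coord_le _) (by positivity)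
        _ = ‖x‖ / 2 := by field_simp
    have h1 := (f s').norm_le_sum_coord hxs'
    have h2 : ∑ l, ‖(f s').coord ((x : N) : X) l‖ ≤
        ∑ l, ‖(f s').coord ((x : N) : X) l - A x l‖ + ∑ l, ‖A x l‖ := by
      rw [← Finset.sum_add_distrib]
      exact Finset.sum_le_sum fun l _ => by
        simpa using norm_add_le ((f s').coord ((x : N) : X) l - A x l) (A x l)
    have h3 : ‖((x : N) : X)‖ = ‖x‖ := rfl
    linarith

end L1Frame
end

/-! ### James sequences and reflexivity of subspaces with dominated ball -/

section

variable {𝕜 : Type*} [RCLike 𝕜] {Y : Type*} [NormedAddCommGroup Y] [NormedSpace 𝕜 Y]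

/-- A functional on the dual at distance more than `θ` from the space takes the value `θ` at some
norm-one functional vanishing at finitely many given vectors. -/
theorem exists_dual_eq_of_forall_lt_norm_sub {F : StrongDual 𝕜 (StrongDual 𝕜 Y)} {θ : ℝ}
    (hθ : 0 < θ) (hF : ∀ y, θ < ‖F - NormedSpace.inclusionInDoubleDual 𝕜 Y y‖) (t : Finset Y) :
    ∃ φ : StrongDual 𝕜 Y, ‖φ‖ ≤ 1 ∧ (∀ y ∈ t, φ y = 0) ∧ F φ = θ := by
  by_contra hcon
  push Not at hcon
  have hle : ∀ φ : StrongDual 𝕜 Y, (∀ y ∈ t, φ y = 0) → ‖F φ‖ ≤ θ * ‖φ‖ := by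
    intro φ hφ
    by_contra! hlt
    have hpos : 0 < ‖F φ‖ := lt_of_le_of_lt (by positivity) hlt
    refine hcon (((θ : 𝕜) / F φ) • φ) ?_ (fun y hy => by simp [hφ y hy]) ?_
    · rw [norm_smul, norm_div, RCLike.norm_ofReal, abs_of_pos hθ, div_mul_eq_mul_div]
      exact div_le_one_of_le₀ hlt.le hpos.le
    · rw [map_smul, smul_eq_mul, div_mul_cancel₀ _ (norm_pos_iff.1 hpos)]
  let ev : t → (StrongDual 𝕜 Y →ₗ[𝕜] 𝕜) := fun y =>
    (NormedSpace.inclusionInDoubleDual 𝕜 Y y : StrongDual 𝕜 Y →ₗ[𝕜] 𝕜)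
  let V : Submodule 𝕜 (StrongDual 𝕜 Y) := ⨅ y, LinearMap.ker (ev y)
  have hV : ∀ φ ∈ V, ∀ y ∈ t, φ y = 0 := by
    intro φ hφ y hy
    exact LinearMap.mem_ker.1 ((Submodule.mem_iInf _).1 hφ ⟨y, hy⟩)
  -- `F - G` vanishes on the annihilator of `t`, so it is a combination of evaluations at `t`. Thus
  -- `G`, of norm at most `θ`, is `F` minus an element of `Y`, contrary to `hF`.
  obtain ⟨G, hG, hGn⟩ := exists_extension_norm_eq V (F.comp V.subtypeL)
  have hGθ : ‖G‖ ≤ θ := by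
    rw [hGn]
    exact ContinuousLinearMap.opNorm_le_bound _ hθ.le fun φ => hle φ (hV φ φ.2)
  have hker : V ≤ LinearMap.ker ((F - G : StrongDual 𝕜 (StrongDual 𝕜 Y)) :
      StrongDual 𝕜 Y →ₗ[𝕜] 𝕜) := by
    intro φ hφ
    have h1 : G φ = F φ := hG ⟨φ, hφ⟩
    rw [LinearMap.mem_ker]
    change F φ - G φ = 0
    rw [h1, sub_self]
  have hspan := mem_span_of_iInf_ker_le_ker (L := ev) hker
  obtain ⟨a, ha⟩ := (Submodule.mem_span_range_iff_exists_fun 𝕜).1 hspan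
  have hFG : F - NormedSpace.inclusionInDoubleDual 𝕜 Y (∑ y, a y • (y : Y)) = G := by
    ext φ
    have h1 := congrArg (fun T : StrongDual 𝕜 Y →ₗ[𝕜] 𝕜 => T φ) ha
    have h2 : (F - G) φ = ∑ y, a y * φ (y : Y) := by
      refine Eq.trans h1.symm ?_
      simp [ev]
    have h3 : F φ - G φ = ∑ y, a y * φ (y : Y) := h2
    have h4 : NormedSpace.inclusionInDoubleDual 𝕜 Y (∑ y, a y • (y : Y)) φ = F φ - G φ := by
      rw [h3, NormedSpace.dual_def]
      simp
    change F φ - NormedSpace.inclusionInDoubleDual 𝕜 Y (∑ y, a y • (y : Y)) φ = G φ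
    rw [h4, sub_sub_cancel]
  have := hF (∑ y, a y • (y : Y))
  rw [hFG] at this
  exact absurd hGθ (not_le.2 this)

/-- **Helly's theorem** on approximating an element of the bidual on finitely many functionals. -/
theorem exists_norm_le_one_forall_norm_sub_le {F : StrongDual 𝕜 (StrongDual 𝕜 Y)}
    (hF : ‖F‖ ≤ 1) (t : Finset (StrongDual 𝕜 Y)) {η : ℝ} (hη : 0 < η) :
    ∃ y : Y, ‖y‖ ≤ 1 ∧ ∀ φ ∈ t, ‖φ y - F φ‖ ≤ η := by
  classical
  set S : Set (t → 𝕜) := (fun (y : Y) (φ : t) => (φ : StrongDual 𝕜 Y) y) '' {y | ‖y‖ ≤ 1} with hS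
  have hconv : Convex ℝ S := by
    rintro _ ⟨y, hy, rfl⟩ _ ⟨z, hz, rfl⟩ a b ha hb hab
    refine ⟨(a : 𝕜) • y + (b : 𝕜) • z, ?_, ?_⟩
    · simp only [Set.mem_ofPred_eq] at hy hz ⊢
      refine (norm_add_le _ _).trans ?_
      rw [norm_smul, norm_smul, RCLike.norm_ofReal, RCLike.norm_ofReal, abs_of_nonneg ha,
        abs_of_nonneg hb]
      nlinarith
    · ext φ
      simp [RCLike.real_smul_eq_coe_mul]
  have hmem : (fun φ : t => F φ) ∈ closure S := by
    by_contra hnot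
    obtain ⟨g, u, hg1, hg2⟩ := RCLike.geometric_hahn_banach_closed_point (𝕜 := 𝕜)
      hconv.closure isClosed_closure hnot
    -- The separating functional on value vectors is evaluation of a single `ψ`, which has norm at
    -- most `u` although `F ψ` has real part above `u`.
    set ψ : StrongDual 𝕜 Y := ∑ φ : t, g (Pi.single φ 1) • (φ : StrongDual 𝕜 Y) with hψ
    have hgv : ∀ v : t → 𝕜, g v = ∑ φ, g (Pi.single φ 1) * v φ := by
      intro v
      conv_lhs => rw [pi_eq_sum_univ' v]
      rw [map_sum]
      refine Finset.sum_congr rfl fun φ _ => ?_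
      rw [map_smul, smul_eq_mul, mul_comm]
    have hψy : ∀ y : Y, ‖y‖ ≤ 1 → RCLike.re (ψ y) < u := by
      intro y hy
      have h1 := hg1 _ (subset_closure ⟨y, hy, rfl⟩)
      rw [hgv] at h1
      simpa [hψ] using h1
    have hu : 0 < u := by simpa using hψy 0 (by simp)
    have hψn : ‖ψ‖ ≤ u := by
      refine ContinuousLinearMap.opNorm_le_bound _ hu.le fun y => ?_
      obtain ⟨a, ha, ha2⟩ := RCLike.exists_norm_le_one_mul_eq_norm (ψ y)
      by_cases hy : y = 0
      · simp [hy]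
      have hy' : 0 < ‖y‖ := norm_pos_iff.2 hy
      have h1 := hψy (((‖y‖⁻¹ : ℝ) : 𝕜) • a • y) (by
        rw [norm_smul, norm_smul, RCLike.norm_ofReal, abs_of_nonneg (by positivity)]
        calc ‖y‖⁻¹ * (‖a‖ * ‖y‖) ≤ ‖y‖⁻¹ * (1 * ‖y‖) := by gcongr
          _ = 1 := by field_simp)
      rw [ContinuousLinearMap.map_smul, ContinuousLinearMap.map_smul, smul_eq_mul, smul_eq_mul, ha2, RCLike.re_ofReal_mul,
        RCLike.ofReal_re, inv_mul_eq_div, div_lt_iff₀ hy'] at h1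
      exact h1.le
    have h2 : g (fun φ : t => F φ) = F ψ := by
      rw [hgv, hψ]
      simp
    rw [h2] at hg2
    have h3 : RCLike.re (F ψ) ≤ u := by
      refine (RCLike.re_le_norm _).trans ((F.le_opNorm ψ).trans ?_)
      exact (mul_le_of_le_one_left (norm_nonneg _) hF).trans hψn
    linarith
  obtain ⟨_, ⟨y, hy, rfl⟩, hdist⟩ := Metric.mem_closure_iff.1 hmem η hη
  refine ⟨y, hy, fun φ hφ => ?_⟩
  have := (dist_le_pi_dist (fun φ : t => F φ) (fun φ : t => (φ : StrongDual 𝕜 Y) y)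
    ⟨φ, hφ⟩).trans hdist.le
  rwa [dist_comm, dist_eq_norm] at this

/-- **James' criterion**: a complete nonreflexive space contains vectors `y k` and functionals
`φ n` in the unit balls such that `φ n (y k)` vanishes for `k < n` and is close to `θ` for
`n ≤ k`. -/
theorem exists_seq_of_not_isReflexiveSpace [CompleteSpace Y] (h : ¬ IsReflexiveSpace 𝕜 Y) :
    ∃ (θ : ℝ) (φ : ℕ → StrongDual 𝕜 Y) (y : ℕ → Y), 0 < θ ∧ (∀ n, ‖φ n‖ ≤ 1) ∧
      (∀ n, ‖y n‖ ≤ 1) ∧ (∀ n k, k < n → φ n (y k) = 0) ∧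
      ∀ n k, n ≤ k → ‖φ n (y k) - θ‖ ≤ θ / 4 := by
  classical
  unfold IsReflexiveSpace Function.Surjective at h
  push Not at h
  obtain ⟨F₀, hF₀⟩ := h
  have hne : F₀ ≠ 0 := fun h0 => hF₀ 0 (by simp [h0])
  have hn : 0 < ‖F₀‖ := (norm_nonneg F₀).lt_of_ne' fun h0 => hne (F₀.opNorm_zero_iff.1 h0)
  set F : StrongDual 𝕜 (StrongDual 𝕜 Y) := ((‖F₀‖⁻¹ : ℝ) : 𝕜) • F₀ with hF
  have hF1 : ‖F‖ ≤ 1 := by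
    refine (F₀.opNorm_smul_le _).trans_eq ?_
    rw [RCLike.norm_ofReal, abs_of_nonneg (by positivity), inv_mul_cancel₀ hn.ne']
  have hFr : F ∉ Set.range (NormedSpace.inclusionInDoubleDual 𝕜 Y) := by
    rintro ⟨y, hy⟩
    refine hF₀ ((‖F₀‖ : 𝕜) • y) ?_
    rw [map_smul, hy, hF, smul_smul]
    have : (‖F₀‖ : 𝕜) ≠ 0 := by exact_mod_cast hn.ne'
    push_cast
    rw [mul_inv_cancel₀ this, one_smul]
  have hcl : IsClosed (Set.range (NormedSpace.inclusionInDoubleDual 𝕜 Y)) := by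
    have h1 := (NormedSpace.inclusionInDoubleDualLi (E := Y) 𝕜).isometry.isUniformInducing
    exact h1.isComplete_range.isClosed
  obtain ⟨r, hr, hball⟩ := Metric.isOpen_iff.1 hcl.isOpen_compl F hFr
  set θ := r / 2 with hθ
  have hθ0 : 0 < θ := by positivity
  have hdist : ∀ y, θ < ‖F - NormedSpace.inclusionInDoubleDual 𝕜 Y y‖ := by
    intro y
    by_contra! hle
    refine hball (a := NormedSpace.inclusionInDoubleDual 𝕜 Y y) ?_ ⟨y, rfl⟩
    rw [Metric.mem_ball, dist_comm]
    exact ((dist_eq_norm F (NormedSpace.inclusionInDoubleDual 𝕜 Y y)).trans_le hle).trans_lt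
      (by linarith)
  -- Each new functional kills all earlier vectors while `F` takes the value `θ` on it; each new
  -- vector then imitates `F` on all functionals so far.
  obtain ⟨p, hp, hpr⟩ := exists_seq_of_forall_finset_exists
    (fun q : StrongDual 𝕜 Y × Y => ‖q.1‖ ≤ 1 ∧ ‖q.2‖ ≤ 1 ∧ F q.1 = θ ∧ ‖q.1 q.2 - θ‖ ≤ θ / 4)
    (fun q q' => q'.1 q.2 = 0 ∧ ‖q.1 q'.2 - θ‖ ≤ θ / 4) (by
      intro s hs
      obtain ⟨φ, hφ1, hφ2, hφ3⟩ := exists_dual_eq_of_forall_lt_norm_sub hθ0 hdist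
        (s.image Prod.snd)
      obtain ⟨y, hy1, hy2⟩ := exists_norm_le_one_forall_norm_sub_le hF1
        (insert φ (s.image Prod.fst)) (η := θ / 4) (by positivity)
      refine ⟨(φ, y), ⟨hφ1, hy1, hφ3, ?_⟩, fun q hq => ⟨?_, ?_⟩⟩
      · have := hy2 φ (Finset.mem_insert_self _ _)
        rwa [hφ3] at this
      · exact hφ2 _ (Finset.mem_image_of_mem _ hq)
      · have := hy2 q.1 (Finset.mem_insert_of_mem (Finset.mem_image_of_mem _ hq))
        rwa [(hs q hq).2.2.1] at this)
  refine ⟨θ, fun n => (p n).1, fun n => (p n).2, hθ0, fun n => (hp n).1, fun n => (hp n).2.1,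
    fun n k hkn => (hpr k n hkn).1, fun n k hnk => ?_⟩
  rcases hnk.eq_or_lt with h1 | h1
  · subst h1; exact (hp n).2.2.2
  · exact (hpr n k h1).2

/-- Dyadic averages of functionals with a triangular pattern of values increase any energy that
obeys the parallelogram law and is bounded below on functionals with a large value. -/
theorem exists_average_energy {x : ℕ → Y} {ψ : ℕ → StrongDual 𝕜 Y} {Q : StrongDual 𝕜 Y → ℝ}
    {θ c : ℝ} {N : ℕ} (hψ : ∀ n, ‖ψ n‖ ≤ 1) (hψ0 : ∀ n k, k < n → ψ n (x k) = 0)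
    (hψθ : ∀ n k, n ≤ k → θ ≤ RCLike.re (ψ n (x k)))
    (hQ : ∀ u v, Q u + Q v = 2 * Q ((1 / 2 : 𝕜) • (u + v)) + Q (u - v) / 2)
    (hc : ∀ u, ‖u‖ ≤ 2 → ∀ k < N, θ ≤ ‖u (x k)‖ → 4 * c ≤ Q u) (p : ℕ) :
    ∀ a, a + 2 ^ p ≤ N → ∃ m : StrongDual 𝕜 Y, ‖m‖ ≤ 1 ∧
      (∀ k, a + 2 ^ p ≤ k + 1 → θ ≤ RCLike.re (m (x k))) ∧ (∀ k, k < a → m (x k) = 0) ∧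
      ∃ n, Q m + p * c ≤ Q (ψ n) := by
  induction p with
  | zero =>
    intro a _
    exact ⟨ψ a, hψ a, fun k hk => hψθ a k (by simpa using hk), fun k hk => hψ0 a k hk, a, by simp⟩
  | succ p ih =>
    intro a ha
    have hpow : 2 ^ (p + 1) = 2 ^ p + 2 ^ p := by ring
    have hpos : 0 < 2 ^ p := by positivity
    obtain ⟨m₁, hm₁, hm₁θ, hm₁0, n₁, hn₁⟩ := ih a (by omega)
    obtain ⟨m₂, hm₂, hm₂θ, hm₂0, n₂, hn₂⟩ := ih (a + 2 ^ p) (by omega)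
    -- At the last index of the first block `m₁` is already large and `m₂` still vanishes. By the
    -- parallelogram law the average has energy at least `c` below the larger of the two.
    have hgap : 4 * c ≤ Q (m₁ - m₂) := by
      refine hc _ ((norm_sub_le _ _).trans (by linarith)) (a + 2 ^ p - 1) (by omega) ?_
      rw [sub_apply, hm₂0 _ (by omega), sub_zero]
      exact (hm₁θ _ (by omega)).trans (RCLike.re_le_norm _)
    have hpar := hQ m₁ m₂
    refine ⟨(1 / 2 : 𝕜) • (m₁ + m₂), ?_, fun k hk => ?_, fun k hk => ?_, ?_⟩
    · rw [norm_smul]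
      have h1 := norm_add_le m₁ m₂
      have h2 : ‖(1 / 2 : 𝕜)‖ = 1 / 2 := by simp
      rw [h2]
      linarith
    · have h1 := hm₁θ k (by omega)
      have h2 := hm₂θ k (by omega)
      have h3 : RCLike.re (((1 / 2 : 𝕜) • (m₁ + m₂)) (x k)) =
          1 / 2 * (RCLike.re (m₁ (x k)) + RCLike.re (m₂ (x k))) := by
        have : (1 / 2 : 𝕜) = ((1 / 2 : ℝ) : 𝕜) := by push_cast; rfl
        rw [smul_apply, smul_eq_mul, this, RCLike.re_ofReal_mul, add_apply, map_add]
      rw [h3]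
      linarith
    · simp [hm₁0 k hk, hm₂0 k (by omega)]
    · push_cast
      rcases le_total (Q m₁) (Q m₂) with h1 | h1
      · exact ⟨n₂, by linarith⟩
      · exact ⟨n₁, by linarith⟩

variable {X : Type*} [NormedAddCommGroup X] [NormedSpace 𝕜 X]

/-- A complete subspace whose unit ball is dominated is reflexive. -/
theorem L1Frame.isReflexiveSpace_of_dominated {K : ℝ} (hK : 0 < K)
    (f : Finset X → L1Frame 𝕜 X K) (U : Ultrafilter (Finset X))
    (hU : ∀ x, ∀ᶠ s in (U : Filter (Finset X)), x ∈ (f s).space) {M : Submodule 𝕜 X}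
    [CompleteSpace M] (hd : Dominated f U {x | x ∈ M ∧ ‖x‖ ≤ 1}) : IsReflexiveSpace 𝕜 M := by
  by_contra hnr
  obtain ⟨θ, φ, y, hθ, hφ, hy, hφ0, hφθ⟩ := exists_seq_of_not_isReflexiveSpace hnr
  choose ψ hψ hψn using fun n => exists_extension_norm_eq M (φ n)
  obtain ⟨t, C, hC, ht⟩ := hd (θ / 8) (by positivity)
  set W : ℝ := C * (K * ∑ y ∈ t, ‖y‖) + 1 with hW
  have hW0 : 0 < W := by positivity
  set c : ℝ := θ ^ 2 / (16 * W) with hc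
  have hc0 : 0 < c := by positivity
  -- The weight mass `W` does not depend on the frame, so the number of halvings can be fixed before
  -- the frame is chosen; `p * c > W` exceeds the available energy.
  obtain ⟨p, hp⟩ := exists_nat_gt (W / c)
  rw [div_lt_iff₀ hc0] at hp
  obtain ⟨s, hs1, hs2⟩ := (((Finset.range (2 ^ p)).eventually_all.2 fun k _ =>
    hU (y k : X)).and ((Finset.range (2 ^ p)).eventually_all.2 fun k _ =>
      ht (y k : X) ⟨(y k).2, hy k⟩)).exists
  set w : Fin (f s).size → ℝ := fun i => C * ∑ y ∈ t, ‖(f s).coord y i‖ with hw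
  have hw0 : ∀ l, 0 ≤ w l := fun l =>
    mul_nonneg hC (Finset.sum_nonneg fun _ _ => norm_nonneg _)
  have hwW : ∑ i, w i ≤ W := ((f s).sum_weight_le t hC).trans (by linarith)
  let Q : StrongDual 𝕜 X → ℝ := fun u => ∑ i, w i * ‖u ((f s).vec i)‖ ^ 2
  have hQ0 : ∀ u, 0 ≤ Q u := fun u => Finset.sum_nonneg fun i _ =>
    mul_nonneg (hw0 i) (sq_nonneg _)
  have hQ1 : ∀ u, ‖u‖ ≤ 1 → Q u ≤ W := by
    intro u hu
    refine le_trans (Finset.sum_le_sum fun i _ => ?_) hwW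
    refine mul_le_of_le_one_right (hw0 i) (pow_le_one₀ (norm_nonneg _) ?_)
    exact (u.le_opNorm _).trans (mul_le_one₀ hu (norm_nonneg _) ((f s).norm_vec_le i))
  have hpar : ∀ u v, Q u + Q v = 2 * Q ((1 / 2 : 𝕜) • (u + v)) + Q (u - v) / 2 := by
    intro u v
    simp only [Q, Finset.mul_sum, Finset.sum_div, ← Finset.sum_add_distrib]
    refine Finset.sum_congr rfl fun i _ => ?_
    have h1 := parallelogram_law_with_norm ℝ (u ((f s).vec i)) (v ((f s).vec i))
    have h2 : ‖((1 / 2 : 𝕜) • (u + v)) ((f s).vec i)‖ =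
        1 / 2 * ‖u ((f s).vec i) + v ((f s).vec i)‖ := by
      rw [smul_apply, smul_eq_mul, norm_mul, add_apply]
      simp
    rw [h2, sub_apply]
    linear_combination (-w i / 2) * h1
  -- The truncation error contributes at most `2 * θ / 8`, leaving `θ / 2` for the weighted sum.
  -- Cauchy–Schwarz then gives `(θ / 2) ^ 2 ≤ W * Q u`, which is where `c` comes from.
  have hgap : ∀ u : StrongDual 𝕜 X, ‖u‖ ≤ 2 → ∀ k < 2 ^ p, 3 * θ / 4 ≤ ‖u (y k : X)‖ →
      4 * c ≤ Q u := by
    intro u hu k hk hle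
    have htr : ∀ i, ∃ a : 𝕜, ‖a‖ ≤ w i ∧ ‖(f s).coord (y k : X) i - a‖ =
        max (‖(f s).coord (y k : X) i‖ - w i) 0 :=
      fun i => RCLike.exists_truncation _ (hw0 i)
    choose a ha1 ha2 using htr
    have hub : ∀ i, ‖u ((f s).vec i)‖ ≤ 2 := fun i =>
      (u.le_opNorm _).trans ((mul_le_of_le_one_right (norm_nonneg _) ((f s).norm_vec_le i)).trans
        hu)
    have h1 : ‖u (y k : X)‖ ≤ ∑ i, w i * ‖u ((f s).vec i)‖ +
        ∑ i, max (‖(f s).coord (y k : X) i‖ - w i) 0 * 2 := by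
      conv_lhs => rw [← (f s).sum_coord_smul_vec _ (hs1 k (Finset.mem_range.2 hk))]
      rw [map_sum, ← Finset.sum_add_distrib]
      refine (norm_sum_le _ _).trans (Finset.sum_le_sum fun i _ => ?_)
      rw [map_smul, smul_eq_mul, norm_mul, ← ha2]
      calc ‖(f s).coord (y k : X) i‖ * ‖u ((f s).vec i)‖
          ≤ (‖a i‖ + ‖(f s).coord (y k : X) i - a i‖) * ‖u ((f s).vec i)‖ := by
            gcongr
            simpa using norm_add_le (a i) ((f s).coord (y k : X) i - a i)
        _ = ‖a i‖ * ‖u ((f s).vec i)‖ + ‖(f s).coord (y k : X) i - a i‖ * ‖u ((f s).vec i)‖ :=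
            add_mul _ _ _
        _ ≤ _ := by
            gcongr
            · exact ha1 i
            · exact hub i
    rw [← Finset.sum_mul] at h1
    have h2 : ∑ i, max (‖(f s).coord (y k : X) i‖ - w i) 0 ≤ θ / 8 :=
      hs2 k (Finset.mem_range.2 hk)
    have h3 : θ / 2 ≤ ∑ i, w i * ‖u ((f s).vec i)‖ := by linarith
    have h4 : (∑ i, w i * ‖u ((f s).vec i)‖) ^ 2 ≤ (∑ i, w i) * Q u :=
      Finset.sum_sq_le_sum_mul_sum_of_sq_le_mul _ (fun i _ => hw0 i)
        (fun i _ => mul_nonneg (hw0 i) (sq_nonneg _)) (fun i _ => le_of_eq (by ring))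
    have h5 : (θ / 2) ^ 2 ≤ W * Q u :=
      (pow_le_pow_left₀ (by positivity) h3 2).trans
        (h4.trans (mul_le_mul_of_nonneg_right hwW (hQ0 u)))
    have h6 : 4 * c = (θ / 2) ^ 2 / W := by rw [hc]; field_simp; norm_num
    rw [h6, div_le_iff₀ hW0, mul_comm (Q u)]
    exact h5
  obtain ⟨m, -, -, -, n, hn⟩ := exists_average_energy (x := fun k => (y k : X)) (ψ := ψ) (Q := Q)
    (θ := 3 * θ / 4) (c := c) (N := 2 ^ p) (fun n => (hψn n).trans_le (hφ n))
    (fun n k hkn => (hψ n (y k)).trans (hφ0 n k hkn))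
    (fun n k hnk => by
      rw [hψ n (y k)]
      have h1 := (RCLike.abs_re_le_norm _).trans (hφθ n k hnk)
      rw [map_sub, RCLike.ofReal_re] at h1
      have := (abs_le.1 h1).1
      linarith)
    hpar hgap p 0 (by simp)
  have h1 := hQ1 (ψ n) ((hψn n).trans_le (hφ n))
  have h2 := hQ0 m
  linarith

end

/-! ### The dichotomy applied in both directions -/

theorem mainTheorem10 {𝕜 : Type*} [RCLike 𝕜]
    {X : Type*} [NormedAddCommGroup X] [NormedSpace 𝕜 X] [CompleteSpace X]
    (hX : IsScriptLpSpace 𝕜 1 X) :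
    IsSubprojective 𝕜 X ↔
      ¬ ∃ M : Submodule 𝕜 X, IsClosed (M : Set X) ∧ ¬ FiniteDimensional 𝕜 M ∧
        IsReflexiveSpace 𝕜 M := by
  obtain ⟨K, f, hK, hf⟩ := hX.exists_l1Frames
  let U : Ultrafilter (Finset X) := Ultrafilter.of atTop
  have hU : ∀ x, ∀ᶠ s in (U : Filter (Finset X)), x ∈ (f s).space := by
    intro x
    refine Ultrafilter.of_le atTop ?_
    filter_upwards [eventually_ge_atTop {x}] with s hs
    exact hf s (hs (Finset.mem_singleton_self x))
  constructor
  · rintro hsub ⟨M, hMc, hMinf, hMr⟩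
    obtain ⟨N, hNM, -, hNinf, hNcomp⟩ := hsub M hMc hMinf
    by_cases hd : L1Frame.Dominated f U {x | x ∈ N ∧ ‖x‖ ≤ 1}
    · exact hNinf (L1Frame.finiteDimensional_of_dominated hK f U hU hNcomp hd)
    · obtain ⟨x, φ, δ, hδ, hx, hφ, hφx⟩ :=
        L1Frame.exists_of_not_dominated hK f U hU (fun x hx => hx.2) hd
      obtain ⟨g, ψ, hg⟩ := exists_almostBiorthogonal (fun n => (hx n).2) hK.le hφ hδ hφx
      exact hg.not_isReflexiveSpace (fun n => hNM (hx _).1) hMr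
  · intro hno M hMc hMinf
    by_cases hd : L1Frame.Dominated f U {x | x ∈ M ∧ ‖x‖ ≤ 1}
    · have : CompleteSpace M := hMc.completeSpace_coe
      exact absurd ⟨M, hMc, hMinf, L1Frame.isReflexiveSpace_of_dominated hK f U hU hd⟩ hno
    · obtain ⟨x, φ, δ, hδ, hx, hφ, hφx⟩ :=
        L1Frame.exists_of_not_dominated hK f U hU (fun x hx => hx.2) hd
      obtain ⟨g, ψ, hg⟩ := exists_almostBiorthogonal (fun n => (hx n).2) hK.le hφ hδ hφx
      exact hg.exists_closedComplemented hMc (fun n => (hx _).1)
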